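/- All graphs are finite undirected multigraphs (loops and parallel edges allowed). Let $G$ be a graph with a variable $x_e$ for each edge $e$. Orient the edges arbitrarily, let $\xi$ be the signed $E(G)\times V(G)$ incidence matrix (the row of a loop is zero), let $\hat\xi$ be $\xi$ with the column of one arbitrary vertex deleted, let $A=\mathrm{diag}(x_e)_{e\in E(G)}$, and put $$M_G=\begin{pmatrix}A&\hat\xi\\-\hat\xi^{T}&0\end{pmatrix}.$$ For $I,J,K\subseteq E(G)$ with $|I|=|J|$, the Dodgson polynomial $\Psi^{I,J}_K\in\mathbb Z[x_e:e\in E(G)]$ is the determinant of the matrix obtained from $M_G$ by deleting the rows indexed by $I$ and the columns indexed by $J$ and setting $x_e=0$ for all $e\in K$; up to sign it does not depend on the choices made. A set $S\subseteq E(G)$ with $|S|=5$ *splits* if $\Psi^{I,J}_K$ is identically zero for some $I,J,K$ with $I\cup J\cup K=S$, $I\cap K=J\cap K=\emptyset$, and either $|I|=|J|=2$, $|K|=1$, $|I\cap J|=0$, or $|I|=|J|=3$, $|K|=0$, $|I\cap J|=1$. The graph $G$ is *Feynman 5-split* (for short, *split*) if every $5$-element set $S\subseteq E(G)$ splits. **Proposition**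 (splitting is a minor-closed property). Let $G$ be a split graph. 1. For every edge $e$ of $G$, the deletion $G\setminus e$ is split. 2. For every edge $e$ of $G$, the contraction $G/e$ is split (contracting a loop means deleting it). 3. Consequently every graph isomorphic to one obtained from $G$ by a finite sequence of edge deletions and edge contractions is split. 4. If moreover $G$ is connected, then every minor of $G$ is split, that is, every graph isomorphic to one obtained from $G$ by a finite sequence of edge deletions, edge contractions and vertex deletions. -/

import Mathlib

open scoped Graph

namespace Graph

universe u v w z

variable {α : Type u} {β : Type v} {α' : Type w} {β' : Type z}

/-! ### The exploded Laplacian and Dodgson polynomials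

Multigraphs (loops and parallel edges allowed) are Mathlib's `Graph α β`, with vertex set `V(G)`
and edge set `E(G)`. The variable of an edge `e` is `MvPolynomial.X e : MvPolynomial β ℤ`. -/

/-- An orientation of `G`: every edge gets a tail and a head, which are its two ends. -/
structure EdgeOrientation (G : Graph α β) where
  tail : E(G) → V(G)
  head : E(G) → V(G)
  isLink : ∀ e : E(G), G.IsLink e (tail e) (head e)

open Classical in
/-- The signed `E(G) × V(G)` incidence matrix. The row of a loop is zero. -/
noncomputable def EdgeOrientation.incMatrix {G : Graph α β} (o : G.EdgeOrientation) :
    Matrix E(G) V(G) (MvPolynomial β ℤ) :=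
  fun e v => (if v = o.head e then 1 else 0) - (if v = o.tail e then 1 else 0)

/-- The incidence matrix with the column of the vertex `r` deleted. -/
noncomputable def EdgeOrientation.redIncMatrix {G : Graph α β} (o : G.EdgeOrientation)
    (r : V(G)) : Matrix E(G) {v : V(G) // v ≠ r} (MvPolynomial β ℤ) :=
  o.incMatrix.submatrix id Subtype.val

open Classical in
/-- The exploded Laplacian `M_G`, for an orientation `o` and a removed vertex `r`. -/
noncomputable def EdgeOrientation.explodedLaplacian {G : Graph α β} (o : G.EdgeOrientation)
    (r : V(G)) :
    Matrix (E(G) ⊕ {v : V(G) // v ≠ r}) (E(G) ⊕ {v : V(G) // v ≠ r}) (MvPolynomial β ℤ) :=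
  Matrix.fromBlocks (Matrix.diagonal fun e : E(G) => MvPolynomial.X (e : β)) (o.redIncMatrix r)
    (-(o.redIncMatrix r).transpose) 0

open Classical in
/-- The substitution `x_e = 0` for all `e ∈ K`. -/
noncomputable def setVarsZero (K : Finset β) : MvPolynomial β ℤ →ₐ[ℤ] MvPolynomial β ℤ :=
  MvPolynomial.aeval fun e => if e ∈ K then 0 else MvPolynomial.X e

/-- The matrix `M_G(I,J)_K`: rows indexed by edges in `I` and columns indexed by edges in `J` are
deleted, and `x_e = 0` for `e ∈ K`. -/
noncomputable def EdgeOrientation.dodgsonMatrix {G : Graph α β} (o : G.EdgeOrientation)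
    (r : V(G)) (I J K : Finset β) :
    Matrix ({e : E(G) // (e : β) ∉ I} ⊕ {v : V(G) // v ≠ r})
      ({e : E(G) // (e : β) ∉ J} ⊕ {v : V(G) // v ≠ r}) (MvPolynomial β ℤ) :=
  ((o.explodedLaplacian r).submatrix (Sum.map Subtype.val id) (Sum.map Subtype.val id)).map
    (setVarsZero K)

open Classical in
/-- The determinant of `M_G(I,J)_K`, where `σ` matches the remaining edge rows with the remaining
edge columns (as the relative order of rows and columns does). -/
noncomputable def EdgeOrientation.dodgson {G : Graph α β} [Fintype V(G)] [Fintype E(G)]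
    (o : G.EdgeOrientation) (r : V(G)) (I J K : Finset β)
    (σ : {e : E(G) // (e : β) ∉ I} ≃ {e : E(G) // (e : β) ∉ J}) : MvPolynomial β ℤ :=
  ((o.dodgsonMatrix r I J K).submatrix id (Equiv.sumCongr σ (Equiv.refl _))).det

/-- `P` is the Dodgson polynomial `Ψ^{I,J}_K` of the finite graph `G`, for some orientation, some
removed vertex and some ordering of the edges. By `IsDodgson.eq_or_eq_neg` and `exists_isDodgson`
below, it exists and is unique up to sign. -/
def IsDodgson (G : Graph α β) (I J K : Finset β) (P : MvPolynomial β ℤ) : Prop :=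
  ∃ (_ : Fintype V(G)) (_ : Fintype E(G)) (o : G.EdgeOrientation) (r : V(G))
    (σ : {e : E(G) // (e : β) ∉ I} ≃ {e : E(G) // (e : β) ∉ J}), P = o.dodgson r I J K σ

/-! ### Splitting -/

open Classical in
/-- `Ψ^{I,J}_K` is one of the thirty Dodgson polynomials associated to the set `S`. -/
def IsConfigIndex (S I J K : Finset β) : Prop :=
  I ∪ J ∪ K = S ∧ Disjoint I K ∧ Disjoint J K ∧
    ((I.card = 2 ∧ J.card = 2 ∧ K.card = 1 ∧ (I ∩ J).card = 0) ∨
      (I.card = 3 ∧ J.card = 3 ∧ K.card = 0 ∧ (I ∩ J).card = 1))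

/-- A set `S` of edges of `G` is a 5-configuration. -/
def IsFiveConfig (G : Graph α β) (S : Finset β) : Prop := (S : Set β) ⊆ E(G) ∧ S.card = 5

/-- A 5-configuration `S` splits if one of its Dodgson polynomials is identically zero. -/
def ConfigSplits (G : Graph α β) (S : Finset β) : Prop :=
  ∃ I J K : Finset β, IsConfigIndex S I J K ∧ G.IsDodgson I J K 0

/-- `G` is Feynman 5-split: each of its 5-configurations splits. -/
def IsSplit (G : Graph α β) : Prop := ∀ S : Finset β, G.IsFiveConfig S → G.ConfigSplits S

/-! ### Minors -/

open Classical in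
/-- The contraction `G / e` of an edge `e` with ends `x` and `y`: the edge is removed and `y` is
identified with `x`. Contracting a loop deletes it; edges parallel to `e` become loops. -/
noncomputable def contractEdge (G : Graph α β) (e : β) (x y : α) : Graph α β :=
  (G.deleteEdges {e}).map fun t => if t = y then x else t

/-- One edge deletion or one edge contraction. -/
inductive EdgeMinorStep : Graph α β → Graph α β → Prop
  | deleteEdge {G : Graph α β} {e : β} (he : e ∈ E(G)) : EdgeMinorStep G (G.deleteEdges {e})
  | contractEdge {G : Graph α β} {e : β} {x y : α} (h : G.IsLink e x y) :
      EdgeMinorStep G (G.contractEdge e x y)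

/-- One edge deletion, edge contraction or vertex deletion. -/
inductive MinorStep : Graph α β → Graph α β → Prop
  | edge {G H : Graph α β} (h : EdgeMinorStep G H) : MinorStep G H
  | deleteVertex {G : Graph α β} {x : α} (hx : x ∈ V(G)) : MinorStep G (G.deleteVerts {x})

/-- Isomorphism of multigraphs. -/
def IsIsomorphic (G : Graph α β) (H : Graph α' β') : Prop :=
  ∃ (f : V(G) ≃ V(H)) (g : E(G) ≃ E(H)), ∀ (e : E(G)) (x y : V(G)),
    G.IsLink e x y ↔ H.IsLink (g e) (f x) (f y)

/-- Up to isomorphism, `H` is obtained from `G` by finitely many edge deletions and edge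
contractions. -/
def IsEdgeMinor (H : Graph α' β') (G : Graph α β) : Prop :=
  ∃ H₀ : Graph α β, Relation.ReflTransGen EdgeMinorStep G H₀ ∧ H₀.IsIsomorphic H

/-- Up to isomorphism, `H` is obtained from `G` by finitely many edge deletions, edge contractions
and vertex deletions. -/
def IsMinor (H : Graph α' β') (G : Graph α β) : Prop :=
  ∃ H₀ : Graph α β, Relation.ReflTransGen MinorStep G H₀ ∧ H₀.IsIsomorphic H

/-- `G` is connected: it has a vertex, and any two vertices are joined by a walk. -/
def IsConnected (G : Graph α β) : Prop :=
  V(G).Nonempty ∧ ∀ x ∈ V(G), ∀ y ∈ V(G), Relation.ReflTransGen G.Adj x y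

/-! ### Dodgson polynomials exist and are unique up to sign -/

/-- Existence. -/
theorem exists_isDodgson (G : Graph α β) (hV : V(G).Finite) (hE : E(G).Finite)
    (hne : V(G).Nonempty) {I J : Finset β} (K : Finset β) (hI : (I : Set β) ⊆ E(G))
    (hJ : (J : Set β) ⊆ E(G)) (h : I.card = J.card) : ∃ P, G.IsDodgson I J K P := by
  classical
  have := hV.fintype
  have := hE.fintype
  have key : ∀ I : Finset β, (I : Set β) ⊆ E(G) →
      Fintype.card {e : E(G) // (e : β) ∈ I} = I.card := by
    intro I hI
    rw [← Fintype.card_coe]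
    exact Fintype.card_congr
      ⟨fun e => ⟨e.1.1, e.2⟩, fun e => ⟨⟨e.1, hI e.2⟩, e.2⟩, fun _ => rfl, fun _ => rfl⟩
  have hc : Fintype.card {e : E(G) // (e : β) ∉ I} = Fintype.card {e : E(G) // (e : β) ∉ J} := by
    rw [Fintype.card_subtype_compl, Fintype.card_subtype_compl, key I hI, key J hJ, h]
  have ho : ∀ e : E(G), ∃ p : V(G) × V(G), G.IsLink e p.1 p.2 := by
    intro e
    obtain ⟨x, y, hxy⟩ := exists_isLink_of_mem_edgeSet e.2
    exact ⟨(⟨x, hxy.left_mem⟩, ⟨y, hxy.right_mem⟩), hxy⟩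
  choose p hp using ho
  exact ⟨_, inferInstance, inferInstance, ⟨fun e => (p e).1, fun e => (p e).2, hp⟩,
    ⟨hne.some, hne.some_mem⟩, Fintype.equivOfCardEq hc, rfl⟩

/-- Deleting either of two vertices gives the same bordered determinant. -/
theorem det_border_eq {m n R : Type*} [Fintype m] [Fintype n] [DecidableEq m] [DecidableEq n]
    [CommRing R]
    (A : Matrix m m R) (B : Matrix m n R) (C : Matrix n m R)
    (hB : ∀ i, ∑ j, B i j = 0) (hC : ∀ j, ∑ i, C i j = 0) (r s : n) :
    (Matrix.fromBlocks A (B.submatrix id (Subtype.val : {v : n // v ≠ r} → n))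
      (C.submatrix (Subtype.val : {v : n // v ≠ r} → n) id) 0).det =
    (Matrix.fromBlocks A (B.submatrix id (Subtype.val : {v : n // v ≠ s} → n))
      (C.submatrix (Subtype.val : {v : n // v ≠ s} → n) id) 0).det := by
  by_cases hrs : r = s
  · subst hrs; rfl
  let τ : {v : n // v ≠ r} ≃ {v : n // v ≠ s} := (Equiv.swap r s).subtypeEquiv (by
    intro a
    rw [not_iff_not, Equiv.swap_apply_eq_iff, Equiv.swap_apply_right])
  have hτ : ∀ v, (τ v : n) = if (v : n) = s then r else v := by
    intro v
    change Equiv.swap r s v = _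
    rw [Equiv.swap_apply_def, if_neg v.2]
  have hsum : ∀ f : n → R, ∑ j, f j = 0 → f r = -∑ u : {v : n // v ≠ r}, f u := by
    intro f hf
    have h1 := Fintype.sum_eq_add_sum_subtype_ne f r
    rw [hf] at h1
    exact eq_neg_of_add_eq_zero_left h1.symm
  let Q : Matrix {v : n // v ≠ r} {v : n // v ≠ r} R :=
    fun u v => if (v : n) = s then -1 else if u = v then 1 else 0
  have hmul : ∀ (f : {v : n // v ≠ r} → R) v,
      ∑ u, f u * Q u v = if (v : n) = s then -∑ u, f u else f v := by
    intro f v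
    by_cases hv : (v : n) = s <;> simp [Q, hv]
  have hQ : Q * Q = 1 := by
    ext u v
    rw [Matrix.mul_apply, hmul, Matrix.one_apply]
    by_cases hv : (v : n) = s
    · have h2 : ∑ w, Q u w = -(if u = v then 1 else 0 : R) := by
        rw [← Finset.add_sum_erase _ _ (Finset.mem_univ v)]
        have h3 : ∀ w ∈ Finset.univ.erase v, Q u w = if u = w then 1 else 0 := by
          intro w hw
          have : (w : n) ≠ s := fun h => Finset.ne_of_mem_erase hw (Subtype.ext (h.trans hv.symm))
          simp [Q, this]
        rw [Finset.sum_congr rfl h3, Finset.sum_ite_eq]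
        by_cases huv : u = v <;> simp [Q, hv, huv]
      rw [if_pos hv, h2, neg_neg]
    · simp [Q, hv]
  have hdet : Q.det * Q.det = 1 := by rw [← Matrix.det_mul, hQ, Matrix.det_one]
  rw [← Matrix.det_submatrix_equiv_self (Equiv.sumCongr (Equiv.refl m) τ)
    (Matrix.fromBlocks A (B.submatrix id (Subtype.val : {v : n // v ≠ s} → n)) _ 0)]
  have hB' : B.submatrix id (fun v => (τ v : n)) =
      B.submatrix id (Subtype.val : {v : n // v ≠ r} → n) * Q := by
    ext i v
    rw [Matrix.mul_apply, hmul]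
    simp only [Matrix.submatrix_apply, id, hτ]
    split_ifs
    · exact hsum _ (hB i)
    · rfl
  have hC' : C.submatrix (fun v => (τ v : n)) id =
      Q.transpose * C.submatrix (Subtype.val : {v : n // v ≠ r} → n) id := by
    ext v i
    rw [Matrix.mul_apply]
    simp_rw [Matrix.transpose_apply, mul_comm (Q _ _)]
    rw [hmul]
    simp only [Matrix.submatrix_apply, id, hτ]
    split_ifs
    · exact hsum (fun j => C j i) (hC i)
    · rfl
  have hM : (Matrix.fromBlocks A (B.submatrix id (Subtype.val : {v : n // v ≠ s} → n))
      (C.submatrix (Subtype.val : {v : n // v ≠ s} → n) id) 0).submatrix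
        (Equiv.sumCongr (Equiv.refl m) τ) (Equiv.sumCongr (Equiv.refl m) τ) =
      Matrix.fromBlocks 1 0 0 Q.transpose *
        Matrix.fromBlocks A (B.submatrix id (Subtype.val : {v : n // v ≠ r} → n))
          (C.submatrix (Subtype.val : {v : n // v ≠ r} → n) id) 0 *
        Matrix.fromBlocks 1 0 0 Q := by
    rw [Matrix.fromBlocks_multiply, Matrix.fromBlocks_multiply]
    simp only [Matrix.one_mul, Matrix.zero_mul, Matrix.mul_one, Matrix.mul_zero, add_zero,
      zero_add]
    rw [← hB', ← hC']
    ext (i | i) (j | j) <;> rfl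
  rw [hM, Matrix.det_mul, Matrix.det_mul, Matrix.det_fromBlocks_zero₂₁,
    Matrix.det_fromBlocks_zero₂₁, Matrix.det_transpose, Matrix.det_one, one_mul,
    mul_right_comm, hdet, one_mul]

theorem EdgeOrientation.sum_incMatrix {G : Graph α β} [Fintype V(G)] (o : G.EdgeOrientation)
    (e : E(G)) : ∑ v, o.incMatrix e v = 0 := by
  simp [EdgeOrientation.incMatrix]

open Classical in
theorem EdgeOrientation.dodgsonMatrix_inl_inl {G : Graph α β} (o : G.EdgeOrientation) (r : V(G))
    (I J K : Finset β) (i j) : o.dodgsonMatrix r I J K (Sum.inl i) (Sum.inl j) =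
      if i.1 = j.1 then setVarsZero K (MvPolynomial.X (i.1 : β)) else 0 := by
  simp [EdgeOrientation.dodgsonMatrix, EdgeOrientation.explodedLaplacian, Matrix.diagonal_apply,
    apply_ite (setVarsZero K)]

theorem EdgeOrientation.setVarsZero_incMatrix {G : Graph α β} (o : G.EdgeOrientation)
    (K : Finset β) (e : E(G)) (v : V(G)) : setVarsZero K (o.incMatrix e v) = o.incMatrix e v := by
  classical
  simp [EdgeOrientation.incMatrix, apply_ite (setVarsZero K)]

theorem EdgeOrientation.dodgsonMatrix_inl_inr {G : Graph α β} (o : G.EdgeOrientation) (r : V(G))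
    (I J K : Finset β) (i v) : o.dodgsonMatrix r I J K (Sum.inl i) (Sum.inr v) =
      o.incMatrix i.1 v.1 := by
  simp [EdgeOrientation.dodgsonMatrix, EdgeOrientation.explodedLaplacian,
    EdgeOrientation.redIncMatrix, EdgeOrientation.setVarsZero_incMatrix]

theorem EdgeOrientation.dodgsonMatrix_inr_inl {G : Graph α β} (o : G.EdgeOrientation) (r : V(G))
    (I J K : Finset β) (v j) : o.dodgsonMatrix r I J K (Sum.inr v) (Sum.inl j) =
      -o.incMatrix j.1 v.1 := by
  simp [EdgeOrientation.dodgsonMatrix, EdgeOrientation.explodedLaplacian,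
    EdgeOrientation.redIncMatrix, EdgeOrientation.setVarsZero_incMatrix]

theorem EdgeOrientation.dodgsonMatrix_inr_inr {G : Graph α β} (o : G.EdgeOrientation) (r : V(G))
    (I J K : Finset β) (v w) : o.dodgsonMatrix r I J K (Sum.inr v) (Sum.inr w) = 0 := by
  simp [EdgeOrientation.dodgsonMatrix, EdgeOrientation.explodedLaplacian]

theorem EdgeOrientation.dodgson_vertex {G : Graph α β} [Fintype V(G)] [Fintype E(G)]
    (o : G.EdgeOrientation) (r s : V(G)) (I J K : Finset β)
    (σ : {e : E(G) // (e : β) ∉ I} ≃ {e : E(G) // (e : β) ∉ J}) :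
    o.dodgson r I J K σ = o.dodgson s I J K σ := by
  classical
  have key : ∀ r : V(G), o.dodgson r I J K σ = (Matrix.fromBlocks
      (Matrix.of fun (i j : {e : E(G) // (e : β) ∉ I}) => if i.1 = (σ j).1 then
        setVarsZero K (MvPolynomial.X (i.1 : β)) else 0)
      ((Matrix.of fun (i : {e : E(G) // (e : β) ∉ I}) (v : V(G)) =>
        o.incMatrix i.1 v).submatrix id
          (Subtype.val : {v : V(G) // v ≠ r} → V(G)))
      ((Matrix.of fun (v : V(G)) (j : {e : E(G) // (e : β) ∉ I}) =>
        -o.incMatrix (σ j).1 v).submatrix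
          (Subtype.val : {v : V(G) // v ≠ r} → V(G)) id) 0).det := by
    intro r
    unfold EdgeOrientation.dodgson
    congr 1
    ext1 i j
    rcases i with i | i <;> rcases j with j | j
    · exact o.dodgsonMatrix_inl_inl r I J K i (σ j)
    · exact o.dodgsonMatrix_inl_inr r I J K i j
    · exact o.dodgsonMatrix_inr_inl r I J K i (σ j)
    · exact o.dodgsonMatrix_inr_inr r I J K i j
  rw [key r, key s]
  refine det_border_eq _ _ _ (fun i => ?_) (fun j => ?_) r s
  · simp only [Matrix.of_apply]
    exact o.sum_incMatrix _
  · simp only [Matrix.of_apply]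
    rw [Finset.sum_neg_distrib, o.sum_incMatrix, neg_zero]

theorem EdgeOrientation.incMatrix_eq_or {G : Graph α β} (o o' : G.EdgeOrientation) (e : E(G)) :
    o'.incMatrix e = o.incMatrix e ∨ o'.incMatrix e = -o.incMatrix e := by
  rcases (o.isLink e).eq_and_eq_or_eq_and_eq (o'.isLink e) with h | h
  · left
    funext v
    have h1 : o.tail e = o'.tail e := Subtype.ext h.1
    have h2 : o.head e = o'.head e := Subtype.ext h.2
    unfold EdgeOrientation.incMatrix
    rw [h1, h2]
  · right
    funext v
    have h1 : o.tail e = o'.head e := Subtype.ext h.1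
    have h2 : o.head e = o'.tail e := Subtype.ext h.2
    rw [Pi.neg_apply]
    unfold EdgeOrientation.incMatrix
    rw [h1, h2, neg_sub]

theorem EdgeOrientation.dodgson_orientation {G : Graph α β} [Fintype V(G)] [Fintype E(G)]
    (o o' : G.EdgeOrientation) (r : V(G)) (I J K : Finset β)
    (σ : {e : E(G) // (e : β) ∉ I} ≃ {e : E(G) // (e : β) ∉ J}) :
    ∃ c : MvPolynomial β ℤ, (c = 1 ∨ c = -1) ∧
      o'.dodgson r I J K σ = c * o.dodgson r I J K σ := by
  classical
  have hε : ∀ e : E(G), ∃ c : MvPolynomial β ℤ, (c = 1 ∨ c = -1) ∧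
      ∀ v, o'.incMatrix e v = c * o.incMatrix e v := by
    intro e
    rcases o.incMatrix_eq_or o' e with h | h
    · exact ⟨1, Or.inl rfl, fun v => by rw [h, one_mul]⟩
    · exact ⟨-1, Or.inr rfl, fun v => by simp [h]⟩
  choose ε hε1 hε3 using hε
  have hprod : ∀ {ι : Type (max u v)} [Fintype ι] (f : ι → MvPolynomial β ℤ),
      (∀ i, f i = 1 ∨ f i = -1) → (∏ i, f i = 1 ∨ ∏ i, f i = -1) := by
    intro ι _ f hf
    refine Finset.prod_induction f (fun x => x = 1 ∨ x = -1) ?_ (Or.inl rfl) (fun i _ => hf i)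
    rintro a b (rfl | rfl) (rfl | rfl) <;> simp
  have hsq : ∀ e, ε e * ε e = 1 := by
    intro e
    rcases hε1 e with h | h <;> simp [h]
  let f : {e : E(G) // (e : β) ∉ I} ⊕ {v : V(G) // v ≠ r} → MvPolynomial β ℤ :=
    Sum.elim (fun i => ε i.1) 1
  let g : {e : E(G) // (e : β) ∉ I} ⊕ {v : V(G) // v ≠ r} → MvPolynomial β ℤ :=
    Sum.elim (fun j => ε (σ j).1) 1
  have hf : ∀ i, f i = 1 ∨ f i = -1 := by
    rintro (i | i)
    · exact hε1 _
    · exact Or.inl rfl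
  have hg : ∀ i, g i = 1 ∨ g i = -1 := by
    rintro (i | i)
    · exact hε1 _
    · exact Or.inl rfl
  refine ⟨(∏ i, g i) * ∏ i, f i, ?_, ?_⟩
  · rcases hprod f hf with h | h <;> rcases hprod g hg with h' | h' <;> simp only [h, h'] <;> simp
  unfold EdgeOrientation.dodgson
  rw [mul_assoc, ← Matrix.det_mul_column, ← Matrix.det_mul_row]
  congr 1
  ext1 i j
  simp only [Matrix.of_apply, Matrix.submatrix_apply, id]
  rcases i with i | i <;> rcases j with j | j <;>
    simp only [Equiv.sumCongr_apply, Sum.map_inl, Sum.map_inr, Equiv.refl_apply,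
      EdgeOrientation.dodgsonMatrix_inl_inl, EdgeOrientation.dodgsonMatrix_inl_inr,
      EdgeOrientation.dodgsonMatrix_inr_inl, EdgeOrientation.dodgsonMatrix_inr_inr, hε3, f, g,
      Sum.elim_inl, Sum.elim_inr, Pi.one_apply]
  · split_ifs with h
    · rw [h, ← mul_assoc, hsq, one_mul]
    · simp
  · ring
  · ring
  · ring

/-- Uniqueness up to sign. -/
theorem IsDodgson.eq_or_eq_neg {G : Graph α β} {I J K : Finset β} {P Q : MvPolynomial β ℤ}
    (hP : G.IsDodgson I J K P) (hQ : G.IsDodgson I J K Q) : P = Q ∨ P = -Q := by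
  classical
  obtain ⟨i1, i2, o, r, σ, rfl⟩ := hP
  obtain ⟨j1, j2, o', r', σ', rfl⟩ := hQ
  obtain rfl := Subsingleton.elim i1 j1
  obtain rfl := Subsingleton.elim i2 j2
  have hσ : ∃ c : MvPolynomial β ℤ, (c = 1 ∨ c = -1) ∧
      o.dodgson r I J K σ = c * o.dodgson r I J K σ' := by
    refine ⟨((Equiv.Perm.sign (Equiv.sumCongr (σ.trans σ'.symm)
      (Equiv.refl {v : V(G) // v ≠ r})) : ℤ) : MvPolynomial β ℤ), ?_, ?_⟩
    · rcases Int.units_eq_one_or (Equiv.Perm.sign (Equiv.sumCongr (σ.trans σ'.symm)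
        (Equiv.refl {v : V(G) // v ≠ r}))) with h | h <;> simp [h]
    · unfold EdgeOrientation.dodgson
      rw [← Matrix.det_permute']
      congr 1
      ext1 i j
      rcases j with j | j <;> simp
  obtain ⟨c, hc, h1⟩ := hσ
  obtain ⟨d, hd, h2⟩ := o'.dodgson_orientation o r I J K σ'
  rw [h1, h2, o'.dodgson_vertex r r']
  rcases hc with rfl | rfl <;> rcases hd with rfl | rfl <;> simp

end Graph

namespace Graph

universe u v w z

variable {α : Type u} {β : Type v} {α' : Type w} {β' : Type z}

/-! ### Null pairs -/

/-! For an edge `e` outside `S` that is not a loop, contraction-deletion writes the Dodgson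
polynomial of `G` as `x_e` times that of `G \ e` plus that of `G / e`, up to signs. If it vanishes
identically, both pieces do, and the same `I, J, K` witness that `S` splits in both minors.

The argument is run on kernels instead of determinants. Over a domain a determinant vanishes exactly
when the matrix has a nonzero kernel vector. Here such a vector is an edge function `a`, zero on
`J`, with a vertex potential `b`, zero at the root, subject to one Ohm-type equation per edge
outside `I` and to conservation at every other vertex (`IsDodgson.hasNullPair`,
`HasNullPair.isDodgson`). Vanishing survives the specialisation `x_e = 0`, giving a second vector.
Eliminating `a e` between the two gives a vector for `G \ e` (`HasNullPair.erase`); the specialised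
vector alone has equal potentials at the ends of `e` and descends to `G / e`
(`HasNullPair.contract`).

Vertex deletion needs connectedness, since every disconnected graph splits trivially: a constant
potential on a component avoiding the root is in the kernel. In a connected graph, a vertex outside
a nonempty subgraph `H` can be absorbed by contracting an edge that leaves `V(H)`; `H` remains a
subgraph. Repeating this makes `H` spanning, and then edge deletions suffice (`IsSplit.of_le`). -/

open Classical in
/-- A pair of an edge vector `a` and a vertex vector `b` in the kernel of the exploded Laplacian
with diagonal `y`, with the vertex `r` and the rows `I` and columns `J` removed. -/
structure IsNullPair {R : Type*} [CommRing R] (V : Set α) (E : Finset β) (t h : β → α) (r : α)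
    (I J : Finset β) (y : β → R) (a : β → R) (b : α → R) : Prop where
  root : b r = 0
  supp : ∀ e ∈ J, a e = 0
  edge : ∀ e ∈ E, e ∉ I → y e * a e + (b (h e) - b (t e)) = 0
  flow : ∀ v ∈ V, v ≠ r →
    ∑ e ∈ E, ((if v = h e then a e else 0) - (if v = t e then a e else 0)) = 0

/-- There is a nonzero null pair. -/
def HasNullPair {R : Type*} [CommRing R] (V : Set α) (E : Finset β) (t h : β → α) (r : α)
    (I J : Finset β) (y : β → R) : Prop :=
  ∃ a b, IsNullPair V E t h r I J y a b ∧ ((∃ e ∈ E, a e ≠ 0) ∨ ∃ v ∈ V, b v ≠ 0)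

theorem IsNullPair.linear_comb {R : Type*} [CommRing R] {V : Set α} {E : Finset β} {t h : β → α}
    {r : α} {I J : Finset β} {y : β → R} {a a' : β → R} {b b' : α → R}
    (H : IsNullPair V E t h r I J y a b) (H' : IsNullPair V E t h r I J y a' b') (c d : R) :
    IsNullPair V E t h r I J y (fun e => c * a e - d * a' e) (fun v => c * b v - d * b' v) where
  root := by simp [H.root, H'.root]
  supp e he := by simp [H.supp e he, H'.supp e he]
  edge e he hI := by linear_combination c * H.edge e he hI - d * H'.edge e he hI
  flow v hv hr := by
    have h1 := congrArg (c * ·) (H.flow v hv hr)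
    have h2 := congrArg (d * ·) (H'.flow v hv hr)
    simp only [mul_zero, Finset.mul_sum] at h1 h2
    have h3 := congrArg₂ (· - ·) h1 h2
    simp only [← Finset.sum_sub_distrib, sub_zero] at h3
    refine Eq.trans (Finset.sum_congr rfl fun e _ => ?_) h3
    split_ifs <;> ring

open Classical in
/-- Null pairs of `G` for the coefficients `0` and `y e` at `e` give one of `G \ e`. -/
theorem HasNullPair.erase {R : Type*} [CommRing R] [IsDomain R] {V : Set α} {E : Finset β}
    {t h : β → α} {r : α} {I J : Finset β} {y : β → R} {e : β} (he : e ∈ E) (heI : e ∉ I)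
    (hy : y e ≠ 0) (ht : t e ∈ V) (hh : h e ∈ V) (H : HasNullPair V E t h r I J y)
    (H₀ : HasNullPair V E t h r I J (Function.update y e 0)) :
    HasNullPair V (E.erase e) t h r I J y := by
  -- The two coefficient functions differ only at `e`. Once the equation of `e` is dropped, both
  -- pairs solve one linear system and can be combined.
  have key : ∀ {y' : β → R} {a b}, (∀ f ≠ e, y' f = y f) → IsNullPair V E t h r I J y' a b →
      IsNullPair V E t h r (insert e I) J y a b := by
    intro y' a b hy' hab
    refine ⟨hab.root, hab.supp, fun f hf hfI => ?_, hab.flow⟩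
    rw [Finset.mem_insert, not_or] at hfI
    rw [← hy' f hfI.1]
    exact hab.edge f hf hfI.2
  have fin : ∀ {a b}, IsNullPair V E t h r (insert e I) J y a b → a e = 0 →
      ((∃ e ∈ E, a e ≠ 0) ∨ ∃ v ∈ V, b v ≠ 0) → HasNullPair V (E.erase e) t h r I J y := by
    intro a b hab hae hne
    refine ⟨a, b, ⟨hab.root, hab.supp, fun f hf hfI => ?_, fun v hv hr => ?_⟩, ?_⟩
    · exact hab.edge f (Finset.mem_of_mem_erase hf)
        (by simp [Finset.ne_of_mem_erase hf, hfI])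
    · rw [Finset.sum_erase _ (by simp [hae])]
      exact hab.flow v hv hr
    · refine hne.imp_left ?_
      rintro ⟨f, hf, hfa⟩
      exact ⟨f, Finset.mem_erase.2 ⟨fun h => hfa (h ▸ hae), hf⟩, hfa⟩
  obtain ⟨a, b, hab, hne⟩ := H
  obtain ⟨a', b', hab', hne'⟩ := H₀
  have k := key (fun _ _ => rfl) hab
  have k' := key (fun f hf => Function.update_of_ne hf _ _) hab'
  by_cases hae : a e = 0
  · exact fin k hae hne
  by_cases hae' : a' e = 0
  · exact fin k' hae' hne'
  -- This combination vanishes at `e`. If it vanished everywhere, `a' e • b = a e • b'` on `V`; but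
  -- `b'` agrees at the two ends of `e`, so the equation of `e` for `b` would force `a' e * (y e * a
  -- e) = 0`.
  refine fin (k.linear_comb k' (a' e) (a e)) (by ring) ?_
  by_contra! hcon
  obtain ⟨h1, h2⟩ := hcon
  have e1 := hab.edge e he heI
  have e2 := hab'.edge e he heI
  rw [Function.update_self, zero_mul, zero_add] at e2
  have : a' e * (y e * a e) = 0 := by
    linear_combination a' e * e1 - a e * e2 - h2 _ hh + h2 _ ht
  simp [hae, hae', hy] at this

open Classical in
/-- A null pair with coefficient `0` at the nonloop `e` gives one of `G / e`. -/
theorem HasNullPair.contract {R : Type*} [CommRing R] {V : Set α} {E : Finset β}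
    {t h : β → α} {x y : α} {I J : Finset β} {c : β → R} {e : β} (he : e ∈ E) (heI : e ∉ I)
    (hc : c e = 0) (hxy : x ≠ y) (hx : x ∈ V) (hl : (t e = x ∧ h e = y) ∨ (t e = y ∧ h e = x))
    (H : HasNullPair V E t h y I J c) :
    HasNullPair (V \ {y}) (E.erase e) (fun f => if t f = y then x else t f)
      (fun f => if h f = y then x else h f) x I J c := by
  obtain ⟨a, b, hab, hne⟩ := H
  have hby := hab.root
  -- With coefficient 0, the equation of `e` says that its ends have equal potential. Taking `y` as
  -- root makes both zero, so `x` can be the root of the contraction.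
  have hbx : b x = 0 := by
    have := hab.edge e he heI
    rw [hc, zero_mul, zero_add] at this
    rcases hl with ⟨h1, h2⟩ | ⟨h1, h2⟩ <;> simpa [h1, h2, hby] using this
  have hb : ∀ v, b (if v = y then x else v) = b v := by
    intro v
    split_ifs with hv
    · rw [hv, hbx, hby]
    · rfl
  refine ⟨a, b, ⟨hbx, hab.supp, fun f hf hfI => ?_, fun v hv hvx => ?_⟩, ?_⟩
  · rw [hb, hb]
    exact hab.edge f (Finset.mem_of_mem_erase hf) hfI
  · have hvy : v ≠ y := hv.2
    have hv' : ∀ w, (v = if w = y then x else w) ↔ v = w := by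
      intro w
      split_ifs with hw
      · simp [hw, hvx, hvy]
      · rfl
    simp only [hv']
    -- The edge `e` contributes nothing at `v`, which is neither of its ends.
    rw [Finset.sum_erase]
    · exact hab.flow v hv.1 hvy
    · rcases hl with ⟨h1, h2⟩ | ⟨h1, h2⟩ <;> simp [h1, h2, hvx, hvy]
  · by_contra! hcon
    obtain ⟨h1, h2⟩ := hcon
    -- If all other edge values vanish, conservation at `x`, which is not the root of `G`, leaves
    -- only `± a e`.
    have hae : a e = 0 := by
      have := hab.flow x hx hxy
      rw [Finset.sum_eq_single_of_mem e he] at this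
      · rcases hl with ⟨h1, h2⟩ | ⟨h1, h2⟩ <;> simpa [h1, h2, hxy] using this
      · intro f hf hfe
        simp [h1 f (Finset.mem_erase.2 ⟨hfe, hf⟩)]
    rcases hne with ⟨f, hf, hfa⟩ | ⟨v, hv, hvb⟩
    · by_cases hfe : f = e
      · exact hfa (hfe ▸ hae)
      · exact hfa (h1 f (Finset.mem_erase.2 ⟨hfe, hf⟩))
    · by_cases hvy : v = y
      · exact hvb (hvy ▸ hby)
      · exact hvb (h2 v ⟨hv, hvy⟩)

open Classical in
/-- Null pairs are transported along bijections of vertices and edges. -/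
theorem HasNullPair.transport {R : Type*} [CommRing R] {V : Set α} {E : Finset β}
    {t h : β → α} {r : α} {I J : Finset β} {c : β → R} (H : HasNullPair V E t h r I J c)
    {V' : Set α'} {E' : Finset β'} {η : β → β'} {γ : β' → β} {μ : α → α'} {ν : α' → α}
    (hη : ∀ e ∈ E, η e ∈ E') (hγ : ∀ e ∈ E', γ e ∈ E) (hγη : ∀ e ∈ E, γ (η e) = e)
    (hηγ : ∀ e ∈ E', η (γ e) = e) (hμ : ∀ v ∈ V, μ v ∈ V') (hν : ∀ v ∈ V', ν v ∈ V)
    (hνμ : ∀ v ∈ V, ν (μ v) = v) (hμν : ∀ v ∈ V', μ (ν v) = v) (hJ : J ⊆ E)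
    (hr : r ∈ V) (ht : ∀ e ∈ E, t e ∈ V) (hh : ∀ e ∈ E, h e ∈ V) {c' : β' → R}
    (hc : ∀ e ∈ E, c' (η e) = c e) :
    HasNullPair V' E' (fun e => μ (t (γ e))) (fun e => μ (h (γ e))) (μ r) (I.image η) (J.image η)
      c' := by
  obtain ⟨a, b, hab, hne⟩ := H
  refine ⟨fun e => a (γ e), fun v => b (ν v), ⟨?_, ?_, ?_, ?_⟩, ?_⟩
  · simp [hνμ r hr, hab.root]
  · intro e he
    obtain ⟨f, hf, rfl⟩ := Finset.mem_image.1 he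
    rw [hγη f (hJ hf), hab.supp f hf]
  · intro e he heI
    rw [hνμ _ (hh _ (hγ e he)), hνμ _ (ht _ (hγ e he))]
    have := hab.edge (γ e) (hγ e he) (fun hI' => heI (by
      rw [← hηγ e he]; exact Finset.mem_image_of_mem _ hI'))
    rwa [← hc _ (hγ e he), hηγ e he] at this
  · intro v hv hvr
    have h0 := hab.flow (ν v) (hν v hv) (fun h => hvr (by rw [← h, hμν v hv]))
    refine Eq.trans (Finset.sum_nbij' γ η hγ hη hηγ hγη fun e he => ?_) h0
    have : ∀ w ∈ V, (v = μ w ↔ ν v = w) := fun w hw =>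
      ⟨fun h => by rw [h, hνμ w hw], fun h => by rw [← h, hμν v hv]⟩
    simp only [this _ (hh _ (hγ e he)), this _ (ht _ (hγ e he))]
  · rcases hne with ⟨e, he, hea⟩ | ⟨v, hv, hvb⟩
    · exact Or.inl ⟨η e, hη e he, by simpa only [hγη e he] using hea⟩
    · exact Or.inr ⟨μ v, hμ v hv, by simpa only [hνμ v hv] using hvb⟩

/-! ### Vanishing of Dodgson polynomials -/

theorem sum_subtype_eq_sum_of_eq_zero {ι M : Type*} [Fintype ι] [AddCommMonoid M] (p : ι → Prop)
    [DecidablePred p] (f : ι → M) (hf : ∀ i, ¬ p i → f i = 0) :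
    ∑ i : {i // p i}, f i = ∑ i, f i := by
  rw [← Fintype.sum_subtype_add_sum_subtype p f,
    Finset.sum_eq_zero (s := (Finset.univ : Finset {i // ¬ p i})) fun i _ => hf i i.2, add_zero]

-- Because `a` vanishes on `J` and `b` at `r`, the sums over surviving columns may run over all
-- edges and vertices, which turns the row into the edge equation of a null pair.
open Classical in
theorem EdgeOrientation.dodgsonMatrix_map_mulVec_inl {R : Type*} [CommRing R] {G : Graph α β}
    [Fintype V(G)] [Fintype E(G)] (o : G.EdgeOrientation) (r : V(G)) (I J K : Finset β)
    (φ : MvPolynomial β ℤ →+* R) {a : β → R} {b : α → R} (ha : ∀ e ∈ J, a e = 0) (hb : b r = 0)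
    (i : {e : E(G) // (e : β) ∉ I}) :
    ((o.dodgsonMatrix r I J K).map φ).mulVec
      (Sum.elim (fun j => a j.1) (fun v => b v.1)) (Sum.inl i) =
    φ (setVarsZero K (MvPolynomial.X (i.1 : β))) * a i.1 +
      (b (o.head i.1) - b (o.tail i.1)) := by
  simp only [Matrix.mulVec, dotProduct, Fintype.sum_sum_type, Sum.elim_inl, Sum.elim_inr,
    Matrix.map_apply, EdgeOrientation.dodgsonMatrix_inl_inl,
    EdgeOrientation.dodgsonMatrix_inl_inr]
  congr 1
  · rw [sum_subtype_eq_sum_of_eq_zero (fun e : E(G) => (e : β) ∉ J) (fun e : E(G) =>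
      φ (if i.1 = e then setVarsZero K (MvPolynomial.X (i.1 : β)) else 0) * a e)
      fun e he => by simp [ha _ (not_not.1 he)]]
    simp [apply_ite φ]
  · rw [sum_subtype_eq_sum_of_eq_zero (fun v : V(G) => v ≠ r)
      (fun v : V(G) => φ (o.incMatrix i.1 v) * b v) fun v hv => by simp [not_not.1 hv, hb]]
    simp [EdgeOrientation.incMatrix, apply_ite φ, sub_mul, Finset.sum_sub_distrib]

open Classical in
theorem EdgeOrientation.dodgsonMatrix_map_mulVec_inr {R : Type*} [CommRing R] {G : Graph α β}
    [Fintype V(G)] [Fintype E(G)] (o : G.EdgeOrientation) (r : V(G)) (I J K : Finset β)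
    (φ : MvPolynomial β ℤ →+* R) {a : β → R} {b : α → R} (ha : ∀ e ∈ J, a e = 0)
    (v : {v : V(G) // v ≠ r}) :
    ((o.dodgsonMatrix r I J K).map φ).mulVec
      (Sum.elim (fun j => a j.1) (fun v => b v.1)) (Sum.inr v) =
    -∑ e : E(G), ((if (v.1 : α) = o.head e then a e else 0) -
      (if (v.1 : α) = o.tail e then a e else 0)) := by
  simp only [Matrix.mulVec, dotProduct, Fintype.sum_sum_type, Sum.elim_inl, Sum.elim_inr,
    Matrix.map_apply, EdgeOrientation.dodgsonMatrix_inr_inl,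
    EdgeOrientation.dodgsonMatrix_inr_inr]
  rw [sum_subtype_eq_sum_of_eq_zero (fun e : E(G) => (e : β) ∉ J)
    (fun e : E(G) => φ (-o.incMatrix e v.1) * a e) fun e he => by simp [ha _ (not_not.1 he)]]
  simp [EdgeOrientation.incMatrix, apply_ite φ, sub_mul, Finset.sum_sub_distrib, Subtype.ext_iff]

/-- A singular matrix over a domain has a nonzero kernel vector. The homomorphism `φ` covers the
identity, the specialisation `x_e = 0` and the renaming of variables at once, since each preserves
the vanishing of the determinant. -/
theorem IsDodgson.hasNullPair {R : Type*} [CommRing R] [IsDomain R] {G : Graph α β}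
    {I J K : Finset β} (H : G.IsDodgson I J K 0) {E : Finset β} (hE : (E : Set β) = E(G))
    {t h : β → α} (hth : ∀ e ∈ E(G), G.IsLink e (t e) (h e)) {r : α} (hr : r ∈ V(G))
    (φ : MvPolynomial β ℤ →+* R) :
    HasNullPair V(G) E t h r I J fun e => φ (setVarsZero K (MvPolynomial.X e)) := by
  classical
  obtain ⟨i1, i2, o', r', σ, hσ⟩ := H
  let o : G.EdgeOrientation := ⟨fun e => ⟨t e, (hth e e.2).left_mem⟩,
    fun e => ⟨h e, (hth e e.2).right_mem⟩, fun e => hth e e.2⟩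
  let r₀ : V(G) := ⟨r, hr⟩
  -- Uniqueness up to sign allows any orientation and any root; contraction relies on this freedom.
  have h0 : o.dodgson r₀ I J K σ = 0 := by
    have h1 : G.IsDodgson I J K 0 := ⟨i1, i2, o', r', σ, hσ⟩
    have h2 : G.IsDodgson I J K (o.dodgson r₀ I J K σ) := ⟨i1, i2, o, r₀, σ, rfl⟩
    rcases h2.eq_or_eq_neg h1 with h | h <;> simpa using h
  have h1 := congrArg φ h0
  unfold EdgeOrientation.dodgson at h1
  rw [RingHom.map_det, map_zero, RingHom.mapMatrix_apply, ← Matrix.submatrix_map,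
    ← Matrix.exists_mulVec_eq_zero_iff] at h1
  obtain ⟨w, hw0, hw⟩ := h1
  set τ := Equiv.sumCongr σ (Equiv.refl {v : V(G) // v ≠ r₀}) with hτ
  rw [Matrix.submatrix_mulVec_equiv, Function.comp_id] at hw
  -- The kernel vector, with its columns matched through `τ`, is extended by zero to deleted columns
  -- and to labels outside the graph.
  set a : β → R := fun e => if he : ∃ h : e ∈ E(G), e ∉ J then
    w (τ.symm (Sum.inl ⟨⟨e, he.choose⟩, he.choose_spec⟩)) else 0 with ha
  set b : α → R := fun v => if hv : ∃ h : v ∈ V(G), (⟨v, h⟩ : V(G)) ≠ r₀ then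
    w (τ.symm (Sum.inr ⟨⟨v, hv.choose⟩, hv.choose_spec⟩)) else 0 with hb
  have hwab : w ∘ τ.symm = Sum.elim (fun j => a j.1) (fun v => b v.1) := by
    funext j
    rcases j with j | v
    · have : ∃ h : (j.1 : β) ∈ E(G), (j.1 : β) ∉ J := ⟨j.1.2, j.2⟩
      simp only [Function.comp_apply, Sum.elim_inl, ha, dif_pos this]
    · have : ∃ h : (v.1 : α) ∈ V(G), (⟨v.1, h⟩ : V(G)) ≠ r₀ := ⟨v.1.2, v.2⟩
      simp only [Function.comp_apply, Sum.elim_inr, hb, dif_pos this]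
  have haJ : ∀ e ∈ J, a e = 0 := fun e he => dif_neg fun ⟨_, h⟩ => h he
  have hbr : b r = 0 := dif_neg fun ⟨_, h⟩ => h rfl
  rw [hwab] at hw
  have hEmem : ∀ e, e ∈ E ↔ e ∈ E(G) := fun e => by rw [← hE, Finset.mem_coe]
  refine ⟨a, b, ⟨hbr, haJ, fun e he heI => ?_, fun v hv hvr => ?_⟩, ?_⟩
  · have := congrFun hw (Sum.inl ⟨⟨e, (hEmem e).1 he⟩, heI⟩)
    rwa [o.dodgsonMatrix_map_mulVec_inl r₀ I J K φ haJ hbr] at this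
  · have := congrFun hw (Sum.inr ⟨⟨v, hv⟩, fun h => hvr (congrArg Subtype.val h)⟩)
    rw [o.dodgsonMatrix_map_mulVec_inr r₀ I J K φ haJ, Pi.zero_apply, neg_eq_zero] at this
    exact (Finset.sum_subtype E hEmem
      (fun e => (if v = h e then a e else 0) - if v = t e then a e else 0)).trans this
  · by_contra! hcon
    apply hw0
    have h2 : w ∘ τ.symm = 0 := by
      rw [hwab]
      funext j
      rcases j with j | v
      · exact hcon.1 _ ((hEmem _).2 j.1.2)
      · exact hcon.2 _ v.1.2
    funext i
    simpa using congrFun h2 (τ i)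

theorem HasNullPair.isDodgson {G : Graph α β} (hV : V(G).Finite) {I J K : Finset β}
    {E : Finset β} (hE : (E : Set β) = E(G)) {t h : β → α}
    (hth : ∀ e ∈ E(G), G.IsLink e (t e) (h e)) {r : α} (hr : r ∈ V(G))
    (hI : I ⊆ E) (hJ : J ⊆ E) (hIJ : I.card = J.card)
    (H : HasNullPair V(G) E t h r I J fun e => setVarsZero K (MvPolynomial.X e)) :
    G.IsDodgson I J K 0 := by
  classical
  -- Only the finiteness instances and a matching `σ` of rows with columns are needed from here.
  obtain ⟨-, i1, i2, -, -, σ, -⟩ := G.exists_isDodgson hV (hE ▸ E.finite_toSet) ⟨r, hr⟩ K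
    (hE ▸ Finset.coe_subset.2 hI) (hE ▸ Finset.coe_subset.2 hJ) hIJ
  let o : G.EdgeOrientation := ⟨fun e => ⟨t e, (hth e e.2).left_mem⟩,
    fun e => ⟨h e, (hth e e.2).right_mem⟩, fun e => hth e e.2⟩
  let r₀ : V(G) := ⟨r, hr⟩
  refine ⟨i1, i2, o, r₀, σ, Eq.symm ?_⟩
  obtain ⟨a, b, hab, hne⟩ := H
  have hEmem : ∀ e, e ∈ E ↔ e ∈ E(G) := fun e => by rw [← hE, Finset.mem_coe]
  have hu : (o.dodgsonMatrix r₀ I J K).mulVec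
      (Sum.elim (fun j => a j.1) (fun v => b v.1)) = 0 := by
    have hid : o.dodgsonMatrix r₀ I J K =
      (o.dodgsonMatrix r₀ I J K).map (RingHom.id (MvPolynomial β ℤ)) := by ext1; rfl
    rw [hid]
    funext i
    rcases i with i | v
    · rw [o.dodgsonMatrix_map_mulVec_inl r₀ I J K _ hab.supp hab.root]
      exact hab.edge _ ((hEmem _).2 i.1.2) i.2
    · rw [o.dodgsonMatrix_map_mulVec_inr r₀ I J K _ hab.supp, Pi.zero_apply, neg_eq_zero]
      have := hab.flow v.1 v.1.2 fun h => v.2 (Subtype.ext h)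
      exact (Finset.sum_subtype E hEmem
        (fun e => (if (v.1 : α) = h e then a e else 0) -
          if (v.1 : α) = t e then a e else 0)).symm.trans this
  unfold EdgeOrientation.dodgson
  rw [← Matrix.exists_mulVec_eq_zero_iff]
  set τ := Equiv.sumCongr σ (Equiv.refl {v : V(G) // v ≠ r₀}) with hτ
  refine ⟨Sum.elim (fun j => a j.1) (fun v => b v.1) ∘ τ, fun h0 => ?_, ?_⟩
  · have h0' : ∀ j, (Sum.elim (fun j => a j.1) (fun v => b v.1) :
        {e : E(G) // (e : β) ∉ J} ⊕ {v : V(G) // v ≠ r₀} → MvPolynomial β ℤ) j = 0 := by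
      intro j
      simpa using congrFun h0 (τ.symm j)
    rcases hne with ⟨e, he, hea⟩ | ⟨v, hv, hvb⟩
    · by_cases heJ : e ∈ J
      · exact hea (hab.supp e heJ)
      · exact hea (h0' (Sum.inl ⟨⟨e, (hEmem e).1 he⟩, heJ⟩))
    · by_cases hvr : v = r
      · exact hvb (hvr ▸ hab.root)
      · exact hvb (h0' (Sum.inr ⟨⟨v, hv⟩, fun h => hvr (congrArg Subtype.val h)⟩))
  · rw [Matrix.submatrix_mulVec_equiv, Function.comp_assoc, Equiv.self_comp_symm,
      Function.comp_id, Function.comp_id, hu]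

/-! ### Splitting under deletion, contraction and isomorphism -/

theorem exists_forall_isLink {G : Graph α β} (hne : V(G).Nonempty) :
    ∃ t h : β → α, ∀ e ∈ E(G), G.IsLink e (t e) (h e) := by
  have : ∀ e, ∃ p : α × α, e ∈ E(G) → G.IsLink e p.1 p.2 := by
    intro e
    by_cases he : e ∈ E(G)
    · obtain ⟨x, y, hxy⟩ := exists_isLink_of_mem_edgeSet he
      exact ⟨(x, y), fun _ => hxy⟩
    · exact ⟨(hne.some, hne.some), fun h => absurd h he⟩
  choose p hp using this
  exact ⟨fun e => (p e).1, fun e => (p e).2, hp⟩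

open Classical in
theorem setVarsZero_X (K : Finset β) (e : β) :
    setVarsZero K (MvPolynomial.X e) = if e ∈ K then 0 else MvPolynomial.X e :=
  MvPolynomial.aeval_X _ _

theorem IsConfigIndex.card_eq {S I J K : Finset β} (h : IsConfigIndex S I J K) :
    I.card = J.card := by
  rcases h.2.2.2 with h | h <;> omega

theorem IsConfigIndex.subsets {S I J K : Finset β} (h : IsConfigIndex S I J K) :
    I ⊆ S ∧ J ⊆ S ∧ K ⊆ S := by
  classical
  rw [← h.1]
  exact ⟨fun x hx => by simp [hx], fun x hx => by simp [hx], fun x hx => by simp [hx]⟩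

open Classical in
theorem IsConfigIndex.image {S I J K : Finset β} (h : IsConfigIndex S I J K) {η : β → β'}
    (hη : Set.InjOn η S) :
    IsConfigIndex (S.image η) (I.image η) (J.image η) (K.image η) := by
  obtain ⟨hI, hJ, hK⟩ := h.subsets
  obtain ⟨h1, h2, h3, h4⟩ := h
  have hdisj : ∀ {A B : Finset β}, A ⊆ S → B ⊆ S → Disjoint A B →
      Disjoint (A.image η) (B.image η) := by
    intro A B hA hB hAB
    rw [Finset.disjoint_left] at hAB ⊢
    intro x hx hx'
    obtain ⟨a, ha, rfl⟩ := Finset.mem_image.1 hx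
    obtain ⟨b, hb, hab⟩ := Finset.mem_image.1 hx'
    exact hAB ha (hη (hB hb) (hA ha) hab ▸ hb)
  have hcard : ∀ {A : Finset β}, A ⊆ S → (A.image η).card = A.card := fun hA =>
    Finset.card_image_of_injOn (hη.mono hA)
  have hint : (I.image η ∩ J.image η).card = (I ∩ J).card := by
    rw [← Finset.image_inter_of_injOn, hcard (Finset.inter_subset_left.trans hI)]
    exact hη.mono (by simp [hI, hJ])
  refine ⟨by rw [← h1, Finset.image_union, Finset.image_union], hdisj hI hK h2, hdisj hJ hK h3, ?_⟩
  rwa [hcard hI, hcard hJ, hcard hK, hint]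

/-- Specialising at `x_e = 0` alters only the coefficient of `e`; this is the source of the second
null pair. -/
theorem setVarsZero_singleton_setVarsZero_X [DecidableEq β] (e : β) (K : Finset β) :
    (fun f => (setVarsZero {e} : MvPolynomial β ℤ →+* MvPolynomial β ℤ) (setVarsZero K (MvPolynomial.X f))) =
      Function.update (fun f => setVarsZero K (MvPolynomial.X f)) e 0 := by
  funext f
  rcases eq_or_ne f e with rfl | hf
  · by_cases hK : f ∈ K <;> simp [setVarsZero_X, hK]
  · by_cases hK : f ∈ K <;> simp [setVarsZero_X, hK, hf]

theorem IsSplit.deleteEdge {G : Graph α β} (hV : V(G).Finite) (hE : E(G).Finite) (hG : G.IsSplit)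
    {e : β} (he : e ∈ E(G)) : (G.deleteEdges {e}).IsSplit := by
  classical
  rintro S ⟨hS, hcard⟩
  rw [edgeSet_deleteEdges] at hS
  obtain ⟨I, J, K, hIJK, hd⟩ := hG S ⟨fun f hf => (hS hf).1, hcard⟩
  refine ⟨I, J, K, hIJK, ?_⟩
  have heS : e ∉ S := fun h => (hS h).2 rfl
  obtain ⟨hI, hJ, hK⟩ := hIJK.subsets
  obtain ⟨x, y, hxy⟩ := exists_isLink_of_mem_edgeSet he
  obtain ⟨t, h, hth⟩ := exists_forall_isLink ⟨x, hxy.left_mem⟩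
  have hS' : S ⊆ hE.toFinset.erase e := fun f hf => Finset.mem_erase.2
    ⟨fun h => heS (h ▸ hf), hE.mem_toFinset.2 (hS hf).1⟩
  have H₁ := hd.hasNullPair hE.coe_toFinset hth hxy.left_mem (RingHom.id _)
  have H₀ := hd.hasNullPair hE.coe_toFinset hth hxy.left_mem
    (setVarsZero {e} : MvPolynomial β ℤ →+* MvPolynomial β ℤ)
  rw [setVarsZero_singleton_setVarsZero_X] at H₀
  refine HasNullPair.isDodgson (G := G.deleteEdges {e}) (E := hE.toFinset.erase e) (t := t)
    (h := h) (r := x) (by simpa using hV) (by simp) ?_ (by simpa using hxy.left_mem)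
    (hI.trans hS') (hJ.trans hS') hIJK.card_eq ?_
  · intro f hf
    simp only [edgeSet_deleteEdges, deleteEdges_isLink] at hf ⊢
    exact ⟨hth f hf.1, hf.2⟩
  · rw [vertexSet_deleteEdges]
    refine HasNullPair.erase (hE.mem_toFinset.2 he) (fun h => heS (hI h)) ?_
      (hth e he).left_mem (hth e he).right_mem H₁ H₀
    -- As `e` lies outside `K`, its coefficient is the variable itself, hence nonzero.
    simpa [setVarsZero_X] using fun h => heS (hK h)

theorem vertexSet_contractEdge {G : Graph α β} {e : β} {x y : α} (hx : x ∈ V(G)) (hxy : x ≠ y) :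
    V(G.contractEdge e x y) = V(G) \ {y} := by
  ext v
  simp only [contractEdge, vertexSet_map, vertexSet_deleteEdges, Set.mem_image, Set.mem_sdiff,
    Set.mem_singleton_iff]
  constructor
  · rintro ⟨w, hw, rfl⟩
    split_ifs with h
    · exact ⟨hx, hxy⟩
    · exact ⟨hw, h⟩
  · rintro ⟨hv, hvy⟩
    exact ⟨v, hv, if_neg hvy⟩

theorem edgeSet_contractEdge (G : Graph α β) (e : β) (x y : α) :
    E(G.contractEdge e x y) = E(G) \ {e} := by
  simp [contractEdge]

theorem contractEdge_self (G : Graph α β) (e : β) (x : α) :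
    G.contractEdge e x x = G.deleteEdges {e} := by
  have : (fun t : α => open Classical in if t = x then x else t) = id := by
    funext t
    by_cases h : t = x <;> simp [h]
  rw [contractEdge, this, map_id]

open Classical in
theorem IsLink.contractEdge {G : Graph α β} {e f : β} {x y u v : α} (h : G.IsLink f u v)
    (hf : f ≠ e) : (G.contractEdge e x y).IsLink f (if u = y then x else u)
      (if v = y then x else v) := by
  have h' : (G.deleteEdges {e}).IsLink f u v := by
    rw [deleteEdges_isLink]
    exact ⟨h, hf⟩
  exact h'.map fun t => if t = y then x else t

theorem IsSplit.contractEdge {G : Graph α β} (hV : V(G).Finite) (hE : E(G).Finite)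
    (hG : G.IsSplit) {e : β} {x y : α} (hl : G.IsLink e x y) :
    (G.contractEdge e x y).IsSplit := by
  classical
  rcases eq_or_ne x y with rfl | hxy
  · rw [contractEdge_self]
    exact hG.deleteEdge hV hE hl.edge_mem
  rintro S ⟨hS, hcard⟩
  rw [edgeSet_contractEdge] at hS
  obtain ⟨I, J, K, hIJK, hd⟩ := hG S ⟨fun f hf => (hS hf).1, hcard⟩
  refine ⟨I, J, K, hIJK, ?_⟩
  have heS : e ∉ S := fun h => (hS h).2 rfl
  obtain ⟨hI, hJ, hK⟩ := hIJK.subsets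
  obtain ⟨t, h, hth⟩ := exists_forall_isLink ⟨x, hl.left_mem⟩
  have hS' : S ⊆ hE.toFinset.erase e := fun f hf => Finset.mem_erase.2
    ⟨fun h => heS (h ▸ hf), hE.mem_toFinset.2 (hS hf).1⟩
  -- The root is `y`, the end that disappears.
  have H₀ := hd.hasNullPair hE.coe_toFinset hth hl.right_mem
    (setVarsZero {e} : MvPolynomial β ℤ →+* MvPolynomial β ℤ)
  rw [setVarsZero_singleton_setVarsZero_X] at H₀
  have H₁ := HasNullPair.contract (hE.mem_toFinset.2 hl.edge_mem) (fun h => heS (hI h))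
    (Function.update_self ..) hxy hl.left_mem ((hth e hl.edge_mem).eq_and_eq_or_eq_and_eq hl) H₀
  refine HasNullPair.isDodgson (G := G.contractEdge e x y) (E := hE.toFinset.erase e)
    (t := fun f => if t f = y then x else t f) (h := fun f => if h f = y then x else h f) (r := x)
    ?_ (by simp [edgeSet_contractEdge]) ?_ ?_ (hI.trans hS') (hJ.trans hS') hIJK.card_eq ?_
  · rw [vertexSet_contractEdge hl.left_mem hxy]
    exact hV.sdiff
  · intro f hf
    rw [edgeSet_contractEdge] at hf
    exact (hth f hf.1).contractEdge hf.2
  · rw [vertexSet_contractEdge hl.left_mem hxy]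
    exact ⟨hl.left_mem, hxy⟩
  · rw [vertexSet_contractEdge hl.left_mem hxy]
    -- The coefficient of `e` was set to zero, but `e` is gone, so the original coefficients give
    -- the same equations.
    obtain ⟨a, b, hab, hne⟩ := H₁
    refine ⟨a, b, ⟨hab.root, hab.supp, fun f hf hfI => ?_, hab.flow⟩, hne⟩
    have := hab.edge f hf hfI
    rwa [Function.update_of_ne (Finset.ne_of_mem_erase hf)] at this

/-- Mutually inverse total functions extending a bijection of subsets. -/
theorem exists_extend_equiv {ι κ : Type*} {A : Set ι} {B : Set κ} (f : A ≃ B)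
    (hA : A.Nonempty) : ∃ (η : ι → κ) (γ : κ → ι), (∀ a : A, η a = f a) ∧ (∀ a ∈ A, η a ∈ B) ∧
      (∀ b ∈ B, γ b ∈ A) ∧ (∀ a ∈ A, γ (η a) = a) ∧ ∀ b ∈ B, η (γ b) = b := by
  classical
  obtain ⟨a₀, ha₀⟩ := hA
  refine ⟨fun a => if h : a ∈ A then f ⟨a, h⟩ else f ⟨a₀, ha₀⟩,
    fun b => if h : b ∈ B then f.symm ⟨b, h⟩ else a₀, fun a => ?_, fun a ha => ?_, fun b hb => ?_,
    fun a ha => ?_, fun b hb => ?_⟩ <;> simp [*]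

/-- The configuration is pulled back to `G`, and a null pair found there is carried forward while
the variables are renamed along the edge bijection. -/
theorem IsSplit.of_isIsomorphic {G : Graph α β} {H : Graph α' β'} (hV : V(G).Finite)
    (hE : E(G).Finite) (hG : G.IsSplit) (hGH : G.IsIsomorphic H) : H.IsSplit := by
  classical
  obtain ⟨f, g, hfg⟩ := hGH
  rintro S ⟨hS, hcard⟩
  -- Five edges in `S` guarantee an edge and a vertex, hence default values for extending the
  -- bijections to total functions.
  have hSne : S.Nonempty := Finset.card_pos.1 (by omega)
  have hEne : E(G).Nonempty := ⟨_, (g.symm ⟨_, hS hSne.choose_spec⟩).2⟩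
  obtain ⟨x, y, hxy⟩ := exists_isLink_of_mem_edgeSet hEne.some_mem
  obtain ⟨η, γ, hη, hηm, hγm, hγη, hηγ⟩ := exists_extend_equiv g hEne
  obtain ⟨μ, ν, hμ, hμm, hνm, hνμ, hμν⟩ := exists_extend_equiv f ⟨x, hxy.left_mem⟩
  have hSγ : Set.InjOn γ S := fun a ha b hb hab => by
    rw [← hηγ a (hS ha), hab, hηγ b (hS hb)]
  have hSη : (S.image γ).image η = S := by
    rw [Finset.image_image]
    exact (Finset.image_congr fun a ha => hηγ a (hS ha)).trans Finset.image_id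
  have hSG : ((S.image γ : Finset β) : Set β) ⊆ E(G) := by
    intro a ha
    obtain ⟨b, hb, rfl⟩ := Finset.mem_image.1 ha
    exact hγm b (hS hb)
  have hηinj : Set.InjOn η E(G) := fun a ha b hb hab => by
    rw [← hγη a ha, hab, hγη b hb]
  obtain ⟨I, J, K, hIJK, hd⟩ := hG (S.image γ)
    ⟨hSG, by rw [Finset.card_image_of_injOn hSγ, hcard]⟩
  have hI'J'K' := hIJK.image (hηinj.mono hSG)
  rw [hSη] at hI'J'K'
  refine ⟨I.image η, J.image η, K.image η, hI'J'K', ?_⟩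
  obtain ⟨hI, hJ, hK⟩ := hIJK.subsets
  obtain ⟨t, h, hth⟩ := exists_forall_isLink ⟨x, hxy.left_mem⟩
  have hS' : S.image γ ⊆ hE.toFinset := fun a ha => hE.mem_toFinset.2 (hSG ha)
  have H₀ := hd.hasNullPair hE.coe_toFinset hth hxy.left_mem
    (MvPolynomial.rename η : MvPolynomial β ℤ →ₐ[ℤ] MvPolynomial β' ℤ).toRingHom
  have hmem : ∀ {e}, e ∈ hE.toFinset ↔ e ∈ E(G) := hE.mem_toFinset
  have himg : ((hE.toFinset.image η : Finset β') : Set β') = E(H) := by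
    ext b
    simp only [Finset.coe_image, hE.coe_toFinset, Set.mem_image]
    exact ⟨fun ⟨a, ha, hab⟩ => hab ▸ hηm a ha, fun hb => ⟨γ b, hγm b hb, hηγ b hb⟩⟩
  have hmem' : ∀ {e}, e ∈ hE.toFinset.image η ↔ e ∈ E(H) := fun {e} => by
    rw [← himg, Finset.mem_coe]
  have hVH : V(H).Finite := by
    refine (hV.image μ).subset fun v hv => ⟨ν v, hνm v hv, hμν v hv⟩
  refine HasNullPair.isDodgson hVH himg (t := fun e => μ (t (γ e))) (h := fun e => μ (h (γ e)))
    (r := μ x) ?_ (hμm x hxy.left_mem) (Finset.image_subset_image (hI.trans hS'))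
    (Finset.image_subset_image (hJ.trans hS')) hI'J'K'.card_eq ?_
  · intro e he
    have hl := hth (γ e) (hγm e he)
    have := (hfg ⟨γ e, hγm e he⟩ ⟨_, hl.left_mem⟩ ⟨_, hl.right_mem⟩).1 hl
    rwa [← hη, ← hμ, ← hμ, hηγ e he] at this
  · refine H₀.transport (η := η) (γ := γ) (μ := μ) (ν := ν)
      (fun e he => hmem'.2 (hηm e (hmem.1 he))) (fun e he => hmem.2 (hγm e (hmem'.1 he)))
      (fun e he => hγη e (hmem.1 he)) (fun e he => hηγ e (hmem'.1 he)) hμm hνm hνμ hμν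
      (hJ.trans hS') hxy.left_mem (fun e he => (hth e (hmem.1 he)).left_mem)
      (fun e he => (hth e (hmem.1 he)).right_mem) fun e he => ?_
    have hK' : η e ∈ K.image η ↔ e ∈ K := by
      constructor
      · intro hm
        obtain ⟨a, ha, hae⟩ := Finset.mem_image.1 hm
        exact hηinj (hSG (hK ha)) (hmem.1 he) hae ▸ ha
      · exact Finset.mem_image_of_mem η
    by_cases heK : e ∈ K <;> simp [setVarsZero_X, hK', heK]

/-! ### Minors of split graphs -/

theorem finite_contractEdge {G : Graph α β} (hV : V(G).Finite) (hE : E(G).Finite) (e : β)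
    (x y : α) : V(G.contractEdge e x y).Finite ∧ E(G.contractEdge e x y).Finite := by
  constructor
  · rw [contractEdge, vertexSet_map, vertexSet_deleteEdges]
    exact hV.image _
  · rw [edgeSet_contractEdge]
    exact hE.sdiff

theorem IsConnected.contractEdge {G : Graph α β} (hG : G.IsConnected) {e : β} {x y : α}
    (hl : G.IsLink e x y) : (G.contractEdge e x y).IsConnected := by
  classical
  let c : α → α := fun t => if t = y then x else t
  have hV : V(G.contractEdge e x y) = c '' V(G) := by
    simp only [Graph.contractEdge, vertexSet_map, vertexSet_deleteEdges, c]
  -- Walks project to the contraction; a step along `e` collapses to a point.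
  have hstep : ∀ u v, G.Adj u v → Relation.ReflTransGen (G.contractEdge e x y).Adj (c u) (c v) := by
    rintro u v ⟨f, hf⟩
    by_cases hfe : f = e
    · subst hfe
      have : c u = c v := by
        rcases hf.eq_and_eq_or_eq_and_eq hl with ⟨rfl, rfl⟩ | ⟨rfl, rfl⟩ <;> simp [c]
      rw [this]
    · exact .single ⟨f, hf.contractEdge hfe⟩
  refine ⟨?_, ?_⟩
  · rw [hV]
    exact hG.1.image c
  · rw [hV]
    rintro _ ⟨u, hu, rfl⟩ _ ⟨v, hv, rfl⟩
    induction hG.2 u hu v hv with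
    | refl => exact .refl
    | @tail w z _ h ih => exact (ih h.left_mem).trans (hstep w z h)

theorem IsSplit.of_le_of_vertexSet_eq {G H : Graph α β} (hV : V(G).Finite) (hE : E(G).Finite)
    (hG : G.IsSplit) (hHG : H ≤ G) (hVH : V(H) = V(G)) : H.IsSplit := by
  have key : ∀ F : Finset β, (F : Set β) ⊆ E(G) → (G.deleteEdges F).IsSplit := by
    classical
    intro F
    induction F using Finset.induction_on with
    | empty => intro _; simpa using hG
    | insert e F he ih =>
      intro hF
      rw [Finset.coe_insert, Set.insert_subset_iff] at hF
      have := (ih hF.2).deleteEdge (by simpa using hV)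
        (by rw [edgeSet_deleteEdges]; exact hE.sdiff) (e := e)
        (by rw [edgeSet_deleteEdges]; exact ⟨hF.1, by simpa using he⟩)
      rwa [deleteEdges_deleteEdges, Set.union_singleton, ← Finset.coe_insert] at this
  have hHeq : H = G.deleteEdges (hE.sdiff (t := E(H))).toFinset := by
    refine Graph.ext (by simpa using hVH) fun e x y => ?_
    rw [deleteEdges_isLink, Set.Finite.coe_toFinset]
    constructor
    · exact fun h => ⟨h.mono hHG, fun he => he.2 h.edge_mem⟩
    · rintro ⟨h, he⟩
      exact (hHG.isLink_iff (by_contra fun hn => he ⟨h.edge_mem, hn⟩)).2 h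
  rw [hHeq]
  exact key _ (by rw [Set.Finite.coe_toFinset]; exact Set.sdiff_subset)

/-- A connected graph has an edge leaving every proper nonempty set of vertices. -/
theorem IsConnected.exists_isLink_of_ssubset {G : Graph α β} (hG : G.IsConnected) {X : Set α}
    (hX : X ⊆ V(G)) (hne : X.Nonempty) {v : α} (hv : v ∈ V(G)) (hvX : v ∉ X) :
    ∃ e x y, G.IsLink e x y ∧ x ∈ X ∧ y ∉ X := by
  by_contra! hcon
  obtain ⟨u, hu⟩ := hne
  have : ∀ w, Relation.ReflTransGen G.Adj u w → w ∈ X := by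
    intro w hw
    induction hw with
    | refl => exact hu
    | tail _ h ih =>
      obtain ⟨e, he⟩ := h
      exact hcon e _ _ he ih
  exact hvX (this v (hG.2 u (hX hu) v hv))

/-- Contraction only relabels `y`, which `H` avoids, and `e` is not an edge of `H` because its end
`y` is missing. -/
theorem le_contractEdge {G H : Graph α β} (hHG : H ≤ G) {e : β} {x y : α}
    (hl : G.IsLink e x y) (hy : y ∉ V(H)) : H ≤ G.contractEdge e x y := by
  classical
  have hne : ∀ v ∈ V(H), (if v = y then x else v) = v := fun v hv =>
    if_neg fun h : v = y => hy (h ▸ hv)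
  refine ⟨fun v hv => ?_, fun f u v hf => ?_⟩
  · rw [contractEdge, vertexSet_map, vertexSet_deleteEdges]
    exact ⟨v, hHG.vertexSet_mono hv, hne v hv⟩
  · have hfe : f ≠ e := by
      rintro rfl
      exact hy ((hHG.isLink_iff hf.edge_mem).2 hl).right_mem
    have := (hf.mono hHG).contractEdge (x := x) (y := y) hfe
    rwa [hne u hf.left_mem, hne v hf.right_mem] at this

/-- Subgraphs of connected split graphs are split. -/
theorem IsSplit.of_le {G H : Graph α β} (hV : V(G).Finite) (hE : E(G).Finite) (hG : G.IsSplit)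
    (hc : G.IsConnected) (hHG : H ≤ G) : H.IsSplit := by
  induction hn : (V(G) \ V(H)).ncard using Nat.strong_induction_on generalizing G with
  | _ n ih =>
    by_cases hVH : V(H) = V(G)
    · exact hG.of_le_of_vertexSet_eq hV hE hHG hVH
    rcases Set.eq_empty_or_nonempty V(H) with hemp | hne
    · rintro S ⟨hS, hcard⟩
      obtain ⟨e, he⟩ := Finset.card_pos.1 (show 0 < S.card by omega)
      obtain ⟨x, y, hxy⟩ := exists_isLink_of_mem_edgeSet (hS he)
      exact absurd hxy.left_mem (by simp [hemp])
    obtain ⟨v, hv, hvH⟩ := Set.exists_of_ssubset (hHG.vertexSet_mono.ssubset_of_ne hVH)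
    -- Contracting an edge from `V(H)` to an outside vertex `y` keeps `H` intact and removes `y`
    -- from the complement, so the induction measure drops.
    obtain ⟨e, x, y, hl, hx, hy⟩ := hc.exists_isLink_of_ssubset hHG.vertexSet_mono hne hv hvH
    have hxy : x ≠ y := fun h => hy (h ▸ hx)
    obtain ⟨hV', hE'⟩ := finite_contractEdge hV hE e x y
    refine ih _ ?_ hV' hE' (hG.contractEdge hV hE hl) (hc.contractEdge hl)
      (le_contractEdge hHG hl hy) rfl
    rw [← hn, vertexSet_contractEdge hl.left_mem hxy]
    refine Set.ncard_lt_ncard ?_ hV.sdiff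
    refine ⟨fun w hw => ⟨hw.1.1, hw.2⟩, fun h => ?_⟩
    exact (h (show y ∈ V(G) \ V(H) from ⟨hl.right_mem, hy⟩)).1.2 rfl

theorem EdgeMinorStep.isSplit {G H : Graph α β} (h : EdgeMinorStep G H) (hV : V(G).Finite)
    (hE : E(G).Finite) (hG : G.IsSplit) : V(H).Finite ∧ E(H).Finite ∧ H.IsSplit := by
  cases h with
  | deleteEdge he =>
    refine ⟨by simpa using hV, ?_, hG.deleteEdge hV hE he⟩
    rw [edgeSet_deleteEdges]
    exact hE.sdiff
  | contractEdge hl =>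
    obtain ⟨hV', hE'⟩ := finite_contractEdge hV hE _ _ _
    exact ⟨hV', hE', hG.contractEdge hV hE hl⟩

/-- The property of being a subgraph of a finite connected split graph. -/
def IsSubgraphOfConnectedSplit (H : Graph α β) : Prop :=
  ∃ G : Graph α β, V(G).Finite ∧ E(G).Finite ∧ G.IsSplit ∧ G.IsConnected ∧ H ≤ G

/-- Deletions shrink only the subgraph, while a contraction is performed in the ambient graph too.
The ambient graph thus stays connected even when the minor does not, and no deletion has to be shown
to preserve connectedness. -/
theorem MinorStep.isSubgraphOfConnectedSplit {H H' : Graph α β} (h : MinorStep H H')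
    (hH : H.IsSubgraphOfConnectedSplit) : H'.IsSubgraphOfConnectedSplit := by
  obtain ⟨G, hV, hE, hG, hc, hHG⟩ := hH
  cases h with
  | deleteVertex hx => exact ⟨G, hV, hE, hG, hc, deleteVerts_le.trans hHG⟩
  | edge h =>
    cases h with
    | deleteEdge he => exact ⟨G, hV, hE, hG, hc, deleteEdges_le.trans hHG⟩
    | @contractEdge e x y hl =>
      have hl' := hl.mono hHG
      obtain ⟨hV', hE'⟩ := finite_contractEdge hV hE e x y
      exact ⟨G.contractEdge e x y, hV', hE', hG.contractEdge hV hE hl', hc.contractEdge hl',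
        IsSubgraph.map _ (deleteEdges_mono_left hHG _)⟩

end Graph

theorem mainTheorem7 {α β α' β' : Type*} (G : Graph α β) (hV : V(G).Finite) (hE : E(G).Finite)
    (hG : G.IsSplit) :
    (∀ e ∈ E(G), (G.deleteEdges {e}).IsSplit) ∧
    (∀ (e : β) (x y : α), G.IsLink e x y → (G.contractEdge e x y).IsSplit) ∧
    (∀ H : Graph α' β', H.IsEdgeMinor G → H.IsSplit) ∧
    (G.IsConnected → ∀ H : Graph α' β', H.IsMinor G → H.IsSplit) := by
  refine ⟨fun e he => hG.deleteEdge hV hE he, fun e x y hl => hG.contractEdge hV hE hl, ?_, ?_⟩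
  · rintro H ⟨H₀, hH₀, hiso⟩
    have : V(H₀).Finite ∧ E(H₀).Finite ∧ H₀.IsSplit := by
      clear hiso
      induction hH₀ with
      | refl => exact ⟨hV, hE, hG⟩
      | tail _ h ih => exact h.isSplit ih.1 ih.2.1 ih.2.2
    exact this.2.2.of_isIsomorphic this.1 this.2.1 hiso
  · rintro hc H ⟨H₀, hH₀, hiso⟩
    have : H₀.IsSubgraphOfConnectedSplit := by
      clear hiso
      induction hH₀ with
      | refl => exact ⟨G, hV, hE, hG, hc, le_rfl⟩
      | tail _ h ih => exact h.isSubgraphOfConnectedSplit ih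
    obtain ⟨G', hV', hE', hG', hc', hle⟩ := this
    exact (hG'.of_le hV' hE' hc' hle).of_isIsomorphic (hV'.subset hle.vertexSet_mono)
      (hE'.subset hle.edgeSet_mono) hiso
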